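/- Let $\mathcal{P}(3^3)$ be the graph whose vertices are the partitions of $\{1,\dots,9\}$ into three cells of size three, where two such partitions are adjacent if each cell of one contains exactly one point from each cell of the other. For $1\le i<j\le 9$ let $S_{i,j}$ be the set of those vertices of $\mathcal{P}(3^3)$ in which $i$ and $j$ lie in the same cell. Then the maximum size of an independent set in $\mathcal{P}(3^3)$ is $70$, and a set $S$ of vertices is an independent set of size $70$ if and only if $S=S_{i,j}$ for some $1\le i<j\le 9$. -/

import Mathlib

/-- The partitions of a nine-element set into three cells of size three. The points `1, …, 9` are
represented by the elements of `Fin 9`. -/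
abbrev ThreeByThree : Type :=
  {P : Finpartition (Finset.univ : Finset (Fin 9)) //
    P.parts.card = 3 ∧ ∀ t ∈ P.parts, t.card = 3}

/-- Two such partitions are skew if each cell of one contains exactly one point from each cell of
the other. -/
def ThreeByThree.Skew (P Q : ThreeByThree) : Prop :=
  ∀ s ∈ P.1.parts, ∀ t ∈ Q.1.parts, (s ∩ t).card = 1

/-- The graph `𝒫(3³)`: the partitions of a nine-element set into three triples, adjacent when they
are skew. -/
def skewGraph : SimpleGraph ThreeByThree where
  Adj P Q := P.Skew Q
  symm := ⟨fun P Q h s hs t ht => by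
    rw [Finset.inter_comm]
    exact h t ht s hs⟩
  loopless := ⟨fun P h => by
    obtain ⟨t, ht⟩ : P.1.parts.Nonempty := by
      rw [← Finset.card_pos, P.2.1]
      norm_num
    have h1 := h t ht t ht
    rw [Finset.inter_self, P.2.2 t ht] at h1
    omega⟩

/-- The set `S_{i,j}` of those partitions in which `i` and `j` lie in the same cell. -/
def sameCell (i j : Fin 9) : Set ThreeByThree :=
  {P | ∃ t ∈ P.1.parts, i ∈ t ∧ j ∈ t}

/-! The four parallel classes of an affine plane of order 3 on the nine points are pairwise skew, so
they form a 4-clique and an independent set `S` contains at most one of them. There are 840 such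
planes and each of the 280 partitions lies in 840·4/280 = 12 of them. Counting incidences gives
12·|S| ≤ 840, hence |S| ≤ 70 (`card_le`), and equality forces `S` to meet every plane exactly once
(`meetsOnce_planes`).

These exact-hitting conditions are solved by a backtracking search with unit propagation, run in the
kernel (`search_planes`) and proved sound in `Consistent.search`: every solution is contained in
some `sameCell i j`. Each `sameCell i j` has 70 elements (`ncard_sameCell`) and is independent,
since two of its members have cells sharing both `i` and `j`; so containment of a 70-element set is
equality.

The computations use bitmasks and positions in a list. `Represents` and `index` carry their results
over to `ThreeByThree`. -/

namespace SkewSearch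

/-! ### Forced evaluation in the kernel -/

/-- Applies `f` to `n`, after reducing `n` to a numeral. -/
noncomputable def force {α : Type} (n : ℕ) (f : ℕ → α) : α :=
  Nat.rec (f 0) (fun k _ => f (Nat.succ k)) n

theorem force_eq {α : Type} (n : ℕ) (f : ℕ → α) : force n f = f n := by
  cases n <;> rfl

/-- Applies `f` to `l`, after reducing `l` to a list of numerals. -/
noncomputable def forceList {α : Type} (l : List ℕ) : (List ℕ → α) → α :=
  List.rec (fun f => f []) (fun x _ ih f => force x fun y => ih fun t => f (y :: t)) l

theorem forceList_eq {α : Type} (l : List ℕ) (f : List ℕ → α) : forceList l f = f l := by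
  induction l generalizing f with
  | nil => rfl
  | cons x l ih =>
    change (force x fun y => forceList l fun t => f (y :: t)) = _
    rw [force_eq, ih]

/-- Applies `f` to `l`, after reducing `l` to a list of lists of numerals. -/
noncomputable def forceLists {α : Type} (l : List (List ℕ)) : (List (List ℕ) → α) → α :=
  List.rec (fun f => f []) (fun x _ ih f => forceList x fun y => ih fun t => f (y :: t)) l

theorem forceLists_eq {α : Type} (l : List (List ℕ)) (f : List (List ℕ) → α) :
    forceLists l f = f l := by
  induction l generalizing f with
  | nil => rfl
  | cons x l ih =>
    change (forceList x fun y => forceLists l fun t => f (y :: t)) = _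
    rw [forceList_eq, ih]

/-! ### Search for exact hitting sets -/

/-- Whether the binary digit of `m` at position `k` is one. -/
def hasBit (m k : ℕ) : Bool := !(Nat.beq (Nat.land 1 (Nat.shiftRight m k)) 0)

theorem hasBit_eq (m k : ℕ) : hasBit m k = m.testBit k := by
  change (!(Nat.beq (1 &&& (m >>> k)) 0)) = ((1 &&& (m >>> k)) != 0)
  rw [Bool.eq_iff_iff, Bool.not_eq_true', bne_iff_ne, Bool.eq_false_iff, ne_eq, Nat.beq_eq]

/-- Passes to `f` the list of the entries of `p` outside the mask `O`, and the list of those of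
them that lie in the mask `I`. -/
noncomputable def classify {α : Type} (I O : ℕ) (p : List ℕ) (f : List ℕ → List ℕ → α) : α :=
  List.rec f (fun k _ ih r s =>
    bif hasBit O k then ih r s else bif hasBit I k then ih (k :: r) (k :: s) else ih (k :: r) s)
    p [] []

/-- Adds the entries of `r` other than `k` to the mask `O`. -/
noncomputable def exclude (k O : ℕ) (r : List ℕ) : ℕ :=
  List.rec O (fun x _ ih => bif Nat.beq k x then ih else Nat.lor (Nat.pow 2 x) ih) r

/-- One round of unit propagation through the constraints in `l`: each of them is a list of which
exactly one entry belongs to the unknown set. The masks `I` and `O` hold the points known to be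
inside and outside, and `acc` collects the constraints that remain open. -/
noncomputable def propagate (l : List (List ℕ)) :
    List (List ℕ) → ℕ → ℕ → Option (List (List ℕ) × ℕ × ℕ) :=
  List.rec (fun acc I O => some (acc, I, O))
    (fun p _ ih acc I O => classify I O p fun r s =>
      List.rec
        (List.rec none (fun k r' _ =>
          List.rec (force (Nat.lor I (Nat.pow 2 k)) fun I' => ih acc I' O)
            (fun _ _ _ => ih (r :: acc) I O) r') r)
        (fun k _ _ => force (exclude k O r) fun O' => ih acc I O') s) l

/-- Backtracking search for the sets that contain `I`, are disjoint from `O` and satisfy the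
constraints in `l`. It verifies that each of them is contained in a set listed in `goals`. -/
noncomputable def search (full : ℕ) (goals : List ℕ) (n : ℕ) : List (List ℕ) → ℕ → ℕ → Bool :=
  Nat.rec (fun _ _ _ => false)
    (fun _ ih l I O =>
      match propagate l [] I O with
      | none => true
      | some (l', I', O') =>
        bif Nat.beq (Nat.land I' O') 0 then
          match l' with
          | [] => goals.any fun g => Nat.beq g (Nat.xor full O')
          | r :: l'' => r.all fun k => force (Nat.lor I' (Nat.pow 2 k)) fun J => ih (r :: l'') J O'
        else true) n

/-! ### Soundness of the search -/

/-- Exactly one member of `p` belongs to `T`. -/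
def MeetsOnce (T : Finset ℕ) (p : List ℕ) : Prop :=
  ∃ k ∈ p, k ∈ T ∧ ∀ l ∈ p, l ∈ T → l = k

/-- The set `T` contains the mask `I`, is disjoint from the mask `O`, and satisfies the constraints
in the list `l`. -/
structure Consistent (T : Finset ℕ) (l : List (List ℕ)) (I O : ℕ) : Prop where
  meets : ∀ p ∈ l, MeetsOnce T p
  inside : ∀ k, I.testBit k → k ∈ T
  outside : ∀ k, O.testBit k → k ∉ T

theorem testBit_lor_two_pow {m k l : ℕ} :
    (Nat.lor m (Nat.pow 2 k)).testBit l = true ↔ m.testBit l = true ∨ k = l := by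
  change (m ||| 2 ^ k).testBit l = true ↔ _
  rw [Nat.testBit_or, Nat.testBit_two_pow]
  simp

theorem testBit_exclude {k O l : ℕ} {r : List ℕ} :
    (exclude k O r).testBit l = true ↔ O.testBit l = true ∨ (l ∈ r ∧ l ≠ k) := by
  induction r with
  | nil => simp [exclude]
  | cons x r ih =>
    have h : exclude k O (x :: r) =
      bif Nat.beq k x then exclude k O r else 2 ^ x ||| exclude k O r := rfl
    rw [h]
    by_cases hx : k = x
    · have hb : Nat.beq k x = true := by rw [hx]; exact Nat.beq_refl x
      rw [hb, cond_true, ih, List.mem_cons]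
      constructor
      · tauto
      · rintro (h | ⟨h | h, h'⟩)
        · exact .inl h
        · exact absurd (h.trans hx.symm) h'
        · exact .inr ⟨h, h'⟩
    · have hb : Nat.beq k x = false := by
        rw [Bool.eq_false_iff]
        exact fun h => hx (Nat.eq_of_beq_eq_true h)
      rw [hb, cond_false, Nat.testBit_or, Bool.or_eq_true, ih, Nat.testBit_two_pow,
        decide_eq_true_iff, List.mem_cons]
      constructor
      · rintro (rfl | h | h)
        · exact .inr ⟨.inl rfl, Ne.symm hx⟩
        · exact .inl h
        · exact .inr ⟨.inr h.1, h.2⟩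
      · rintro (h | ⟨h | h, h'⟩)
        · exact .inr (.inl h)
        · exact .inl h.symm
        · exact .inr (.inr ⟨h, h'⟩)

theorem classify_eq {α : Type} (I O : ℕ) (p : List ℕ) (f : List ℕ → List ℕ → α) :
    ∃ r s, classify I O p f = f r s ∧ (∀ k, k ∈ r ↔ k ∈ p ∧ O.testBit k = false) ∧
      ∀ k ∈ s, k ∈ r ∧ I.testBit k = true := by
  have key : ∀ (p r s : List ℕ), (∀ k ∈ s, k ∈ r ∧ I.testBit k = true) →
      ∃ r' s', (List.rec f (fun k _ ih r s => bif hasBit O k then ih r s else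
        bif hasBit I k then ih (k :: r) (k :: s) else ih (k :: r) s) p : List ℕ → List ℕ → α) r s
          = f r' s' ∧ (∀ k, k ∈ r' ↔ k ∈ r ∨ (k ∈ p ∧ O.testBit k = false)) ∧
      ∀ k ∈ s', k ∈ r' ∧ I.testBit k = true := by
    intro p
    induction p with
    | nil => intro r s h; exact ⟨r, s, rfl, by simp, h⟩
    | cons x p ih =>
      intro r s h
      dsimp only
      rw [hasBit_eq, hasBit_eq]
      cases hO : O.testBit x
      · cases hI : I.testBit x
        · obtain ⟨r', s', h1, h2, h3⟩ := ih (x :: r) s fun k hk =>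
            ⟨List.mem_cons_of_mem _ (h k hk).1, (h k hk).2⟩
          refine ⟨r', s', h1, fun k => ?_, h3⟩
          rw [h2, List.mem_cons, List.mem_cons]
          constructor
          · rintro ((rfl | h) | h) <;> tauto
          · tauto
        · obtain ⟨r', s', h1, h2, h3⟩ := ih (x :: r) (x :: s) fun k hk => by
            rcases List.mem_cons.1 hk with rfl | hk
            · exact ⟨List.mem_cons_self, hI⟩
            · exact ⟨List.mem_cons_of_mem _ (h k hk).1, (h k hk).2⟩
          refine ⟨r', s', h1, fun k => ?_, h3⟩
          rw [h2, List.mem_cons, List.mem_cons]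
          constructor
          · rintro ((rfl | h) | h) <;> tauto
          · tauto
      · obtain ⟨r', s', h1, h2, h3⟩ := ih r s h
        refine ⟨r', s', h1, fun k => ?_, h3⟩
        rw [h2, List.mem_cons]
        constructor
        · tauto
        · rintro (h | ⟨rfl | h, h'⟩)
          · tauto
          · rw [hO] at h'; cases h'
          · tauto
  obtain ⟨r, s, h1, h2, h3⟩ := key p [] [] (by simp)
  exact ⟨r, s, h1, by simpa using h2, h3⟩

/-- Each deduction is forced for a set `T` meeting every constraint once, so no solution is lost and
the failure value `none` never arises when a solution exists. -/
theorem Consistent.propagate {T : Finset ℕ} {l acc : List (List ℕ)} {I O : ℕ}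
    (hl : ∀ p ∈ l, MeetsOnce T p) (h : Consistent T acc I O) :
    ∃ l' I' O', propagate l acc I O = some (l', I', O') ∧ Consistent T l' I' O' := by
  induction l generalizing acc I O with
  | nil => exact ⟨acc, I, O, rfl, h⟩
  | cons p l ih =>
    have hl' : ∀ q ∈ l, MeetsOnce T q := fun q hq => hl q (List.mem_cons_of_mem _ hq)
    obtain ⟨k₀, hk₀, hk₀T, huniq⟩ := hl p List.mem_cons_self
    -- The continuation is spelled out so that `hrs` is, by definition, the unfolding of `propagate`
    -- at `p :: l`.
    obtain ⟨r, s, hrs, hr, hs⟩ := classify_eq I O p fun r s =>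
      (List.rec
        (List.rec none (fun k r' _ =>
          List.rec (force (Nat.lor I (Nat.pow 2 k)) fun I' => SkewSearch.propagate l acc I' O)
            (fun _ _ _ => SkewSearch.propagate l (r :: acc) I O) r') r)
        (fun k _ _ => force (exclude k O r) fun O' => SkewSearch.propagate l acc I O') s :
        Option (List (List ℕ) × ℕ × ℕ))
    have e : SkewSearch.propagate (p :: l) acc I O = _ := hrs
    rw [e]
    have hk₀r : k₀ ∈ r := by
      rw [hr]
      refine ⟨hk₀, ?_⟩
      rw [Bool.eq_false_iff]
      exact fun hO => h.outside _ hO hk₀T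
    cases s with
    | cons k s =>
      dsimp only
      rw [force_eq]
      obtain ⟨hkr, hkI⟩ := hs k List.mem_cons_self
      have hk : k = k₀ := huniq k ((hr k).1 hkr).1 (h.inside k hkI)
      refine ih hl' ⟨h.meets, h.inside, fun x hx => ?_⟩
      rcases testBit_exclude.1 hx with hx | ⟨hx, hxk⟩
      · exact h.outside x hx
      · exact fun hxT => hxk ((huniq x ((hr x).1 hx).1 hxT).trans hk.symm)
    | nil =>
      cases r with
      | nil => cases hk₀r
      | cons k r =>
        cases r with
        | nil =>
          dsimp only
          rw [force_eq]
          refine ih hl' ⟨h.meets, fun x hx => ?_, h.outside⟩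
          rcases testBit_lor_two_pow.1 hx with hx | rfl
          · exact h.inside x hx
          · rwa [← List.mem_singleton.1 hk₀r]
        | cons k' r =>
          dsimp only
          refine ih hl' ⟨fun q hq => ?_, h.inside, h.outside⟩
          rcases List.mem_cons.1 hq with rfl | hq
          · exact ⟨k₀, hk₀r, hk₀T, fun x hx => huniq x ((hr x).1 hx).1⟩
          · exact h.meets q hq

/-- Branching on one open constraint is exhaustive because `T` contains one of its entries. At a
leaf, `T` avoids `O'`, so it lies in the complement of `O'`, which was compared with the goals.
Running out of fuel yields `false`, so the bound `n` cannot hide a solution. -/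
theorem Consistent.search {T : Finset ℕ} {full : ℕ} {goals : List ℕ} {n : ℕ}
    {l : List (List ℕ)} {I O : ℕ} (h : Consistent T l I O)
    (hs : search full goals n l I O = true) (hT : ∀ k ∈ T, full.testBit k) :
    ∃ g ∈ goals, ∀ k ∈ T, g.testBit k := by
  induction n generalizing l I O with
  | zero => cases hs
  | succ n ih =>
    obtain ⟨l', I', O', hp, h'⟩ := Consistent.propagate (acc := []) h.meets
      ⟨by simp, h.inside, h.outside⟩
    -- A branch discarded for overlapping masks admits no solution, so the branch of `T` is not one
    -- of these.
    have h0 : Nat.land I' O' = 0 := by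
      refine Nat.eq_of_testBit_eq fun k => ?_
      change (I' &&& O').testBit k = _
      rw [Nat.testBit_and, Nat.zero_testBit, Bool.eq_false_iff]
      intro hk
      rw [Bool.and_eq_true] at hk
      exact h'.outside k hk.2 (h'.inside k hk.1)
    change (match SkewSearch.propagate l [] I O with
      | none => true
      | some (l', I', O') => bif Nat.beq (Nat.land I' O') 0 then _ else true) = true at hs
    rw [hp] at hs
    dsimp only at hs
    rw [h0, Nat.beq_refl, cond_true] at hs
    match l', h', hs with
    | [], h', hs =>
      obtain ⟨g, hg, hgO⟩ := List.any_eq_true.1 hs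
      refine ⟨g, hg, fun k hk => ?_⟩
      rw [Nat.eq_of_beq_eq_true hgO]
      change (full ^^^ O').testBit k = true
      have : O'.testBit k = false := by
        rw [Bool.eq_false_iff]
        exact fun hO => h'.outside k hO hk
      rw [Nat.testBit_xor, hT k hk, this]
      rfl
    | r :: l'', h', hs =>
      obtain ⟨k, hkr, hk, _⟩ := h'.meets r List.mem_cons_self
      have hsk := List.all_eq_true.1 hs k hkr
      rw [force_eq] at hsk
      refine ih ⟨h'.meets, fun x hx => ?_, h'.outside⟩ hsk
      rcases testBit_lor_two_pow.1 hx with hx | rfl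
      · exact h'.inside x hx
      · exact hk

/-! ### Encoding of partitions and affine planes -/

/-- Whether `k` occurs in the list `l`. -/
noncomputable def occurs (k : ℕ) (l : List ℕ) : Bool :=
  List.rec false (fun x _ ih => bif Nat.beq k x then true else ih) l

/-- The masks of the triples of points. -/
def triples : List ℕ :=
  (List.range 9).flatMap fun k => (List.range k).flatMap fun j => (List.range j).map fun i =>
    Nat.pow 2 i + Nat.pow 2 j + Nat.pow 2 k

/-- The third cell of a partition whose first two cells are given. -/
def third (x : ℕ × ℕ) : ℕ := 511 - x.1 - x.2

/-- Whether the two masks are disjoint triples of points. -/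
noncomputable def isVertex (x : ℕ × ℕ) : Bool :=
  occurs x.1 triples && occurs x.2 triples && Nat.beq (Nat.land x.1 x.2) 0

/-- The first two cells of the partitions into triples, with the cells in increasing order. -/
def vertices : List (ℕ × ℕ) :=
  triples.flatMap fun a => (triples.filter fun b =>
    Nat.beq (Nat.land a b) 0 && Nat.blt a b && Nat.blt b (third (a, b))).map fun b => (a, b)

/-- An invariant of the set of cells of a partition that determines the partition. -/
def code (x : ℕ × ℕ) : ℕ := (x.1 + 2) * (x.2 + 2) * (third x + 2)

/-- The order of this list numbers the vertices: plane entries and bits of the goal masks refer to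
its positions. -/
def codes : List ℕ := vertices.map code

/-- Whether two points lie in the same cell. -/
def together (i j : ℕ) (x : ℕ × ℕ) : Bool :=
  (hasBit x.1 i && hasBit x.1 j) || (hasBit x.2 i && hasBit x.2 j) ||
    (hasBit (third x) i && hasBit (third x) j)

/-- Whether each cell of `x` meets each cell of `y` in one point. -/
noncomputable def isSkew (x y : ℕ × ℕ) : Bool :=
  [x.1, x.2, third x].all fun a => [y.1, y.2, third y].all fun b =>
    occurs (Nat.land a b) [1, 2, 4, 8, 16, 32, 64, 128, 256]

/-- The bitmask of the positions in a list at which a predicate holds. -/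
def maskOf {α : Type} (p : α → Bool) : List α → ℕ
  | [] => 0
  | x :: l => (p x).toNat + 2 * maskOf p l

/-- The bitmasks of the sets of partitions in which two given points lie in the same cell. -/
def goals : List ℕ :=
  (List.range 9).flatMap fun j => (List.range j).map fun i => maskOf (together i j) vertices

/-- The powers of two that make up the mask of a triple. -/
def points (m : ℕ) : List ℕ := ((List.range 9).filter (hasBit m)).map (Nat.pow 2)

/-- The four parallel classes of the affine plane whose points are arranged in a square with the
given rows. -/
def parallelClasses (a b c : List ℕ) : List (ℕ × ℕ) :=
  match a, b, c with
  | [a0, a1, a2], [b0, b1, b2], [c0, c1, c2] =>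
    [(a0 + a1 + a2, b0 + b1 + b2), (a0 + b0 + c0, a1 + b1 + c1),
      (a0 + b1 + c2, a1 + b2 + c0), (a0 + b2 + c1, a1 + b0 + c2)]
  | _, _, _ => []

/-- The reorderings of a list of three elements. -/
def reorderings : List ℕ → List (List ℕ)
  | [x, y, z] => [[x, y, z], [x, z, y], [y, x, z], [y, z, x], [z, x, y], [z, y, x]]
  | _ => []

/-- The affine planes on the nine points, as lists of four parallel classes. -/
def planes : List (List (ℕ × ℕ)) :=
  -- Each plane has exactly one parallel class with 0 and 1 on a common line; its cells are the
  -- rows. Rotating the second and third rows in opposite directions only permutes the other three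
  -- classes, so two orders of the second row suffice, one for each cyclic order: 70·2·6 = 840.
  (vertices.filter (together 0 1)).flatMap fun x =>
    ((reorderings (points x.2)).take 2).flatMap fun b =>
      (reorderings (points (third x))).map fun c => parallelClasses (points x.1) b c

/-- The position of `c` in the list `l`, added to the third argument. -/
noncomputable def position (c : ℕ) (l : List ℕ) : ℕ → ℕ :=
  List.rec (fun w => w) (fun x _ ih w => bif Nat.beq c x then w else ih (Nat.succ w)) l

/-- The affine planes, as lists of positions in a list of codes. -/
noncomputable def planePositions (cs : List ℕ) : List (List ℕ) :=
  planes.map (List.map fun x => force (code x) fun c => position c cs 0)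

/-- The number of occurrences of `k` in the list `l`. -/
noncomputable def multiplicity (k : ℕ) (l : List ℕ) : ℕ → ℕ :=
  List.rec (fun w => w) (fun x _ ih w => bif Nat.beq k x then ih (Nat.succ w) else ih w) l

/-- Whether the entries of a list are distinct. -/
noncomputable def isNodup (l : List ℕ) : Bool :=
  List.rec true (fun x l ih => bif occurs x l then false else ih) l

/-- Whether any two entries of a list are skew. -/
noncomputable def isPairwiseSkew (l : List (ℕ × ℕ)) : Bool :=
  List.rec true (fun x l ih => l.all (isSkew x) && ih) l

/-! ### Kernel computations -/

theorem length_vertices : vertices.length = 280 := by decide +kernel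

theorem isNodup_codes : (forceList codes isNodup) = true := by decide +kernel

theorem length_planes : planes.length = 840 := by decide +kernel

theorem planes_all :
    (planes.all fun p => p.all isVertex && isPairwiseSkew p) = true := by
  decide +kernel

theorem count_together :
    ((List.range 9).all fun j => (List.range j).all fun i =>
      Nat.beq (vertices.filter (together i j)).length 70) = true := by
  decide +kernel

/-- The occurrences are split by residue modulo 16 so that each count scans a shorter list. -/
theorem multiplicity_planePositions :
    (forceList codes fun cs => forceLists (planePositions cs) fun l =>
      (List.range 16).all fun r =>
        forceList (l.flatten.filter fun k => Nat.beq (Nat.mod k 16) r) fun t =>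
        (List.range 280).all fun k =>
          bif Nat.beq (Nat.mod k 16) r then Nat.beq (multiplicity k t 0) 12 else true) = true := by
  decide +kernel

/-- The search starts with nothing decided and uses no symmetry reduction; 30 bounds its branching
depth. -/
theorem search_planes :
    (forceList codes fun cs => forceLists (planePositions cs) fun l => forceList goals fun gs =>
      search (2 ^ 280 - 1) gs 30 l 0 0) = true := by
  decide +kernel
-- Meaning of the Boolean checks
theorem occurs_iff {k : ℕ} {l : List ℕ} : occurs k l = true ↔ k ∈ l := by
  induction l with
  | nil => simp [occurs]
  | cons x l ih =>
    have h : occurs k (x :: l) = bif Nat.beq k x then true else occurs k l := rfl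
    rw [h, List.mem_cons, ← ih, Bool.cond_true_left, Bool.or_eq_true, Nat.beq_eq]

theorem nodup_of_isNodup {l : List ℕ} (h : isNodup l = true) : l.Nodup := by
  induction l with
  | nil => exact List.nodup_nil
  | cons x l ih =>
    change (bif occurs x l then false else isNodup l) = true at h
    rw [Bool.cond_false_left, Bool.and_eq_true, Bool.not_eq_true', Bool.eq_false_iff, ne_eq,
      occurs_iff] at h
    exact List.nodup_cons.2 ⟨h.1, ih h.2⟩

theorem pairwise_of_isPairwiseSkew {l : List (ℕ × ℕ)} (h : isPairwiseSkew l = true) :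
    l.Pairwise fun x y => isSkew x y = true := by
  induction l with
  | nil => exact List.Pairwise.nil
  | cons x l ih =>
    change (l.all (isSkew x) && isPairwiseSkew l) = true at h
    rw [Bool.and_eq_true, List.all_eq_true] at h
    exact List.Pairwise.cons h.1 (ih h.2)

theorem multiplicity_eq (k : ℕ) (l : List ℕ) (w : ℕ) : multiplicity k l w = l.count k + w := by
  induction l generalizing w with
  | nil => exact (Nat.zero_add w).symm
  | cons x l ih =>
    change (bif Nat.beq k x then multiplicity k l (Nat.succ w) else multiplicity k l w) = _
    by_cases h : k = x
    · subst h
      rw [Nat.beq_refl, cond_true, ih, List.count_cons_self]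
      omega
    · have hb : Nat.beq k x = false := by
        rw [Bool.eq_false_iff]
        exact fun e => h (Nat.eq_of_beq_eq_true e)
      rw [hb, cond_false, ih, List.count_cons_of_ne (Ne.symm h)]

theorem position_eq {k : ℕ} {l : List ℕ} (w : ℕ) : position k l w = l.idxOf k + w := by
  induction l generalizing w with
  | nil => exact (Nat.zero_add w).symm
  | cons x l ih =>
    change (bif Nat.beq k x then w else position k l (Nat.succ w)) = _
    by_cases h : k = x
    · subst h
      rw [Nat.beq_refl, cond_true, List.idxOf_cons_self, Nat.zero_add]
    · have hb : Nat.beq k x = false := by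
        rw [Bool.eq_false_iff]
        exact fun e => h (Nat.eq_of_beq_eq_true e)
      rw [hb, cond_false, ih, List.idxOf_cons_ne _ (Ne.symm h)]
      omega

theorem testBit_maskOf {α : Type} (p : α → Bool) (l : List α) (k : ℕ) :
    (maskOf p l).testBit k = true ↔ ∃ x, l[k]? = some x ∧ p x = true := by
  induction l generalizing k with
  | nil => simp [maskOf]
  | cons x l ih =>
    cases k with
    | zero =>
      rw [maskOf, Nat.testBit_zero]
      cases h : p x <;> simp [h]
    | succ k =>
      rw [maskOf, Nat.testBit_succ, List.getElem?_cons_succ, ← ih]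
      have : ((p x).toNat + 2 * maskOf p l) / 2 = maskOf p l := by
        have := Bool.toNat_lt (p x)
        omega
      rw [this]

theorem planePositions_eq :
    planePositions codes = planes.map (List.map fun x => codes.idxOf (code x)) := by
  unfold planePositions
  congr 2
  funext x
  rw [force_eq, position_eq, Nat.add_zero]

theorem nodup_codes : codes.Nodup := by
  have h := isNodup_codes
  rw [forceList_eq] at h
  exact nodup_of_isNodup h

theorem count_planePositions {k : ℕ} (hk : k < 280) :
    (planePositions codes).flatten.count k = 12 := by
  have h := multiplicity_planePositions
  rw [forceList_eq, forceLists_eq] at h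
  have h1 := List.all_eq_true.1 h (k % 16) (List.mem_range.2 (Nat.mod_lt _ (by norm_num)))
  rw [forceList_eq] at h1
  have h2 := List.all_eq_true.1 h1 k (List.mem_range.2 hk)
  change (bif Nat.beq (k % 16) (k % 16) then _ else _) = true at h2
  rw [Nat.beq_refl, cond_true, multiplicity_eq, Nat.beq_eq, Nat.add_zero] at h2
  rwa [List.count_filter (by exact Nat.beq_refl (k % 16))] at h2

/-! ### Masks and partitions -/

/-- The set of points with the given mask. -/
def toSet (m : ℕ) : Finset (Fin 9) := Finset.univ.filter fun i => m.testBit i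

/-- The mask of a set of points. -/
def ofSet (s : Finset (Fin 9)) : ℕ := ∑ i ∈ s, Nat.pow 2 i

theorem toSet_ofSet (s : Finset (Fin 9)) : toSet (ofSet s) = s := by
  revert s; decide +kernel

theorem ofSet_mem_triples {s : Finset (Fin 9)} (hs : s.card = 3) : ofSet s ∈ triples := by
  revert s; decide +kernel

theorem ofSet_toSet {m : ℕ} (hm : m ∈ triples) : ofSet (toSet m) = m := by
  revert m; decide +kernel

theorem card_toSet {m : ℕ} (hm : m ∈ triples) : (toSet m).card = 3 := by
  revert m; decide +kernel

theorem mem_toSet {m : ℕ} {i : Fin 9} : i ∈ toSet m ↔ m.testBit i = true := by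
  simp [toSet]

theorem toSet_inter (m n : ℕ) : toSet m ∩ toSet n = toSet (Nat.land m n) := by
  ext i
  rw [Finset.mem_inter, mem_toSet, mem_toSet, mem_toSet]
  change _ ↔ (m &&& n).testBit i = true
  rw [Nat.testBit_and, Bool.and_eq_true]

/-- Masks of disjoint sets add, and the mask of all nine points is 511. -/
theorem ofSet_compl_union {s t : Finset (Fin 9)} (h : Disjoint s t) :
    ofSet (s ∪ t)ᶜ = third (ofSet s, ofSet t) := by
  have h1 : ofSet (s ∪ t) + ofSet (s ∪ t)ᶜ = 511 := by
    unfold ofSet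
    rw [Finset.sum_add_sum_compl]
    rfl
  have h2 : ofSet (s ∪ t) = ofSet s + ofSet t := Finset.sum_union h
  unfold third
  dsimp only
  omega

/-- The cells of the partition with the given first two cells. -/
def cells (x : ℕ × ℕ) : Finset (Finset (Fin 9)) := {toSet x.1, toSet x.2, toSet (third x)}

/-- The pair `x` of masks gives two cells of the partition `P`. -/
structure Represents (x : ℕ × ℕ) (P : ThreeByThree) : Prop where
  vertex : isVertex x = true
  parts : P.1.parts = cells x

theorem isVertex_iff {x : ℕ × ℕ} :
    isVertex x = true ↔ x.1 ∈ triples ∧ x.2 ∈ triples ∧ Nat.land x.1 x.2 = 0 := by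
  rw [isVertex, Bool.and_eq_true, Bool.and_eq_true, occurs_iff, occurs_iff, Nat.beq_eq, and_assoc]

theorem disjoint_of_land_eq_zero {m n : ℕ} (h : Nat.land m n = 0) :
    Disjoint (toSet m) (toSet n) := by
  rw [Finset.disjoint_iff_inter_eq_empty, toSet_inter, h]
  simp [toSet]

theorem toSet_third {x : ℕ × ℕ} (h : isVertex x = true) :
    toSet (third x) = (toSet x.1 ∪ toSet x.2)ᶜ := by
  obtain ⟨h1, h2, h3⟩ := isVertex_iff.1 h
  have := ofSet_compl_union (disjoint_of_land_eq_zero h3)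
  rw [ofSet_toSet h1, ofSet_toSet h2] at this
  rw [← toSet_ofSet (toSet x.1 ∪ toSet x.2)ᶜ, this]

theorem ofSet_toSet_third {x : ℕ × ℕ} (h : isVertex x = true) :
    ofSet (toSet (third x)) = third x := by
  obtain ⟨h1, h2, h3⟩ := isVertex_iff.1 h
  rw [toSet_third h, ofSet_compl_union (disjoint_of_land_eq_zero h3), ofSet_toSet h1,
    ofSet_toSet h2]

theorem card_toSet_third {x : ℕ × ℕ} (h : isVertex x = true) : (toSet (third x)).card = 3 := by
  obtain ⟨h1, h2, h3⟩ := isVertex_iff.1 h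
  rw [toSet_third h, Finset.card_compl, Finset.card_union_of_disjoint
    (disjoint_of_land_eq_zero h3), card_toSet h1, card_toSet h2]
  rfl

theorem disjoint_cells {x : ℕ × ℕ} (h : isVertex x = true) :
    Disjoint (toSet x.1) (toSet x.2) ∧ Disjoint (toSet x.1) (toSet (third x)) ∧
      Disjoint (toSet x.2) (toSet (third x)) := by
  obtain ⟨-, -, h3⟩ := isVertex_iff.1 h
  rw [toSet_third h]
  exact ⟨disjoint_of_land_eq_zero h3,
    disjoint_compl_right.mono_left Finset.subset_union_left |>.mono_right le_rfl,
    disjoint_compl_right.mono_left Finset.subset_union_right⟩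

theorem ne_of_disjoint_of_card {s t : Finset (Fin 9)} (h : Disjoint s t) (hs : s.card = 3) :
    s ≠ t := by
  rintro rfl
  rw [disjoint_self] at h
  rw [h] at hs
  cases hs

theorem exists_represents {x : ℕ × ℕ} (h : isVertex x = true) : ∃ P, Represents x P := by
  obtain ⟨h1, h2, -⟩ := isVertex_iff.1 h
  obtain ⟨d1, d2, d3⟩ := disjoint_cells h
  have c1 := card_toSet h1
  have c2 := card_toSet h2
  have c3 := card_toSet_third h
  have hc : ∀ t ∈ cells x, t.card = 3 := by
    intro t ht
    simp only [cells, Finset.mem_insert, Finset.mem_singleton] at ht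
    rcases ht with rfl | rfl | rfl <;> assumption
  have hd : (cells x : Set (Finset (Fin 9))).PairwiseDisjoint id := by
    intro s hs t ht hst
    simp only [cells, Finset.coe_insert, Finset.coe_singleton, Set.mem_insert_iff,
      Set.mem_singleton_iff] at hs ht
    rcases hs with rfl | rfl | rfl <;> rcases ht with rfl | rfl | rfl <;>
      first
        | exact absurd rfl hst
        | assumption
        | (apply Disjoint.symm; assumption)
  refine ⟨⟨⟨cells x, Finset.supIndep_iff_pairwiseDisjoint.2 hd, ?_, fun h0 => ?_⟩, ?_, hc⟩, h, rfl⟩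
  · simp only [cells, Finset.sup_insert, Finset.sup_singleton, id]
    rw [toSet_third h]
    exact (sup_assoc _ _ _).symm.trans sup_compl_eq_top
  · have := hc _ h0
    cases this
  · exact Finset.card_eq_three.2 ⟨_, _, _, ne_of_disjoint_of_card d1 c1,
      ne_of_disjoint_of_card d2 c1, ne_of_disjoint_of_card d3 c2, rfl⟩

theorem exists_sorted {α : Type} [LinearOrder α] {s : Finset (Finset (Fin 9))} (hs : s.card = 3)
    {f : Finset (Fin 9) → α} (hf : Function.Injective f) :
    ∃ a b c, s = {a, b, c} ∧ f a < f b ∧ f b < f c := by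
  obtain ⟨a, b, c, hab, hac, hbc, rfl⟩ := Finset.card_eq_three.1 hs
  have key : ∀ a b c : Finset (Fin 9), a ≠ b → b ≠ c → f a ≤ f b → f b ≤ f c →
      f a < f b ∧ f b < f c := fun a b c h1 h2 h3 h4 =>
    ⟨lt_of_le_of_ne h3 (hf.ne h1), lt_of_le_of_ne h4 (hf.ne h2)⟩
  rcases le_total (f a) (f b) with h1 | h1 <;> rcases le_total (f b) (f c) with h2 | h2 <;>
    rcases le_total (f a) (f c) with h3 | h3
  · exact ⟨a, b, c, rfl, key _ _ _ hab hbc h1 h2⟩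
  · exact ⟨a, b, c, rfl, key _ _ _ hab hbc h1 h2⟩
  · exact ⟨a, c, b, by ext; simp; tauto, key _ _ _ hac hbc.symm h3 h2⟩
  · exact ⟨c, a, b, by ext; simp; tauto, key _ _ _ hac.symm hab h3 h1⟩
  · exact ⟨b, a, c, by ext; simp; tauto, key _ _ _ hab.symm hac h1 h3⟩
  · exact ⟨b, c, a, by ext; simp; tauto, key _ _ _ hbc hac.symm h2 h3⟩
  · exact ⟨c, b, a, by ext; simp; tauto, key _ _ _ hbc.symm hab.symm h2 h1⟩
  · exact ⟨c, b, a, by ext; simp; tauto, key _ _ _ hbc.symm hab.symm h2 h1⟩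

/-- Sorting the three cells by mask gives the increasing order required in `vertices`; the last cell
is the complement of the other two. -/
theorem exists_vertex (P : ThreeByThree) : ∃ x ∈ vertices, Represents x P := by
  have hinj : Function.Injective ofSet := Function.LeftInverse.injective toSet_ofSet
  obtain ⟨s, t, u, hP, hst, htu⟩ := exists_sorted P.2.1 hinj
  have hs : s ∈ P.1.parts := by simp [hP]
  have ht : t ∈ P.1.parts := by simp [hP]
  have hu : u ∈ P.1.parts := by simp [hP]
  have dst : Disjoint s t := P.1.disjoint hs ht fun e => by simp [e] at hst
  have dsu : Disjoint s u := P.1.disjoint hs hu fun e => by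
    rw [e] at hst; exact absurd (hst.trans htu) (lt_irrefl _)
  have dtu : Disjoint t u := P.1.disjoint ht hu fun e => by simp [e] at htu
  have hunion : s ∪ t ∪ u = Finset.univ := by
    have := P.1.sup_parts
    rw [hP, Finset.sup_insert, Finset.sup_insert, Finset.sup_singleton] at this
    exact (sup_assoc s t u).trans this
  have hcompl : u = (s ∪ t)ᶜ := by
    refine IsCompl.eq_compl ⟨(Finset.disjoint_union_left.2 ⟨dsu, dtu⟩).symm, ?_⟩
    rw [codisjoint_iff, sup_comm]
    exact hunion
  have hthird : third (ofSet s, ofSet t) = ofSet u := by rw [hcompl, ofSet_compl_union dst]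
  have hland : Nat.land (ofSet s) (ofSet t) = 0 := by
    refine Nat.eq_of_testBit_eq fun k => ?_
    change (ofSet s &&& ofSet t).testBit k = _
    rw [Nat.testBit_and, Nat.zero_testBit, Bool.eq_false_iff]
    intro hk
    rw [Bool.and_eq_true] at hk
    by_cases hk9 : k < 9
    · have h1 : (⟨k, hk9⟩ : Fin 9) ∈ toSet (ofSet s) := mem_toSet.2 hk.1
      have h2 : (⟨k, hk9⟩ : Fin 9) ∈ toSet (ofSet t) := mem_toSet.2 hk.2
      rw [toSet_ofSet] at h1 h2
      exact Finset.disjoint_left.1 dst h1 h2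
    · have hlt : ofSet s < 2 ^ k := by
        have h1 : ofSet s ≤ 511 := by
          have : ofSet s ≤ ofSet Finset.univ :=
            Finset.sum_le_sum_of_subset (Finset.subset_univ s)
          exact this
        have h2 : 2 ^ 9 ≤ 2 ^ k := Nat.pow_le_pow_right (by norm_num) (not_lt.1 hk9)
        omega
      rw [Nat.testBit_lt_two_pow hlt] at hk
      exact absurd hk.1 (by simp)
  have ms := ofSet_mem_triples (P.2.2 s hs)
  have mt := ofSet_mem_triples (P.2.2 t ht)
  refine ⟨(ofSet s, ofSet t), ?_, isVertex_iff.2 ⟨ms, mt, hland⟩, ?_⟩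
  · refine List.mem_flatMap.2 ⟨_, ms, List.mem_map.2 ⟨_, List.mem_filter.2 ⟨mt, ?_⟩, rfl⟩⟩
    rw [hthird, hland]
    simp only [Bool.and_eq_true]
    exact ⟨⟨rfl, by rwa [Nat.blt_eq]⟩, by rwa [Nat.blt_eq]⟩
  · rw [cells, hthird, toSet_ofSet, toSet_ofSet, toSet_ofSet, hP]

theorem Represents.eq {x : ℕ × ℕ} {P Q : ThreeByThree} (hP : Represents x P)
    (hQ : Represents x Q) : P = Q :=
  Subtype.ext (Finpartition.ext (hP.parts.trans hQ.parts.symm))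

/-! ### Numbering the partitions -/

/-- An invariant of partitions, equal to the code of any pair of cells. -/
def signature (P : ThreeByThree) : ℕ := ∏ t ∈ P.1.parts, (ofSet t + 2)

/-- The product ignores the order of the cells, so the unsorted pairs occurring in planes can be
matched with the sorted pairs in `vertices`. -/
theorem Represents.signature_eq {x : ℕ × ℕ} {P : ThreeByThree} (h : Represents x P) :
    signature P = code x := by
  obtain ⟨h1, h2, -⟩ := isVertex_iff.1 h.vertex
  obtain ⟨d1, d2, d3⟩ := disjoint_cells h.vertex
  have n1 := ne_of_disjoint_of_card d1 (card_toSet h1)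
  have n2 := ne_of_disjoint_of_card d2 (card_toSet h1)
  have n3 := ne_of_disjoint_of_card d3 (card_toSet h2)
  rw [signature, h.parts, cells, Finset.prod_insert (by simp [n1, n2]),
    Finset.prod_insert (by simp [n3]), Finset.prod_singleton, ofSet_toSet h1, ofSet_toSet h2,
    ofSet_toSet_third h.vertex, code, mul_assoc]

theorem signature_mem_codes (P : ThreeByThree) : signature P ∈ codes := by
  obtain ⟨x, hx, h⟩ := exists_vertex P
  rw [h.signature_eq]
  exact List.mem_map_of_mem hx

theorem signature_injective : Function.Injective signature := by
  intro P Q h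
  obtain ⟨x, hx, hP⟩ := exists_vertex P
  obtain ⟨y, hy, hQ⟩ := exists_vertex Q
  rw [hP.signature_eq, hQ.signature_eq] at h
  have : x = y := List.inj_on_of_nodup_map nodup_codes hx hy h
  subst this
  exact hP.eq hQ

/-- The position of a partition in the list of vertices. -/
def index (P : ThreeByThree) : ℕ := codes.idxOf (signature P)

theorem index_lt (P : ThreeByThree) : index P < 280 := by
  have := List.idxOf_lt_length_iff.2 (signature_mem_codes P)
  rwa [codes, List.length_map, length_vertices] at this

theorem index_injective : Function.Injective index := by
  intro P Q h
  exact signature_injective ((List.idxOf_inj (signature_mem_codes P)).1 h)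

/-- Turns a position in a plane back into the partition that the plane's entry encodes. -/
theorem Represents.of_index_eq {x : ℕ × ℕ} {P : ThreeByThree} (hx : isVertex x = true)
    (h : index P = codes.idxOf (code x)) : Represents x P := by
  obtain ⟨Q, hQ⟩ := exists_represents hx
  rw [← hQ.signature_eq] at h
  rwa [index_injective h]

theorem Represents.skew {x y : ℕ × ℕ} {P Q : ThreeByThree} (hP : Represents x P)
    (hQ : Represents y Q) (h : isSkew x y = true) : P.Skew Q := by
  have key : ∀ m ∈ [1, 2, 4, 8, 16, 32, 64, 128, 256], (toSet m).card = 1 := by decide +kernel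
  have hcells : ∀ (z : ℕ × ℕ) (s : Finset (Fin 9)), s ∈ cells z →
      ∃ a ∈ [z.1, z.2, third z], s = toSet a := by
    intro z s hs
    simp only [cells, Finset.mem_insert, Finset.mem_singleton] at hs
    rcases hs with rfl | rfl | rfl <;> exact ⟨_, by simp, rfl⟩
  intro s hs t ht
  rw [hP.parts] at hs
  rw [hQ.parts] at ht
  obtain ⟨a, ha, rfl⟩ := hcells x s hs
  obtain ⟨b, hb, rfl⟩ := hcells y t ht
  rw [toSet_inter]
  exact key _ (occurs_iff.1 (List.all_eq_true.1 (List.all_eq_true.1 h a ha) b hb))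

theorem Represents.mem_sameCell {x : ℕ × ℕ} {P : ThreeByThree} (h : Represents x P)
    {i j : Fin 9} : P ∈ sameCell i j ↔ together i j x = true := by
  change (∃ t ∈ P.1.parts, i ∈ t ∧ j ∈ t) ↔ _
  rw [h.parts]
  simp only [cells, Finset.mem_insert, Finset.mem_singleton, exists_eq_or_imp, exists_eq_left,
    mem_toSet, together, hasBit_eq, Bool.or_eq_true, Bool.and_eq_true, or_assoc]

/-! ### Double counting over the planes -/

theorem sum_countP_eq (T : Finset ℕ) (L : List (List ℕ)) :
    (L.map fun p => p.countP (· ∈ T)).sum = ∑ k ∈ T, L.flatten.count k := by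
  have h : ∀ l : List ℕ, l.countP (· ∈ T) = ∑ k ∈ T, l.count k := by
    intro l
    induction l with
    | nil => simp
    | cons x l ih =>
      rw [List.countP_cons, ih]
      simp only [List.count_cons, Finset.sum_add_distrib, beq_iff_eq, Finset.sum_ite_eq,
        decide_eq_true_eq]
  rw [← h, List.countP_flatten]

theorem sum_le_length {α : Type} {f : α → ℕ} {l : List α} (h : ∀ x ∈ l, f x ≤ 1) :
    (l.map f).sum ≤ l.length ∧ ((l.map f).sum = l.length → ∀ x ∈ l, f x = 1) := by
  induction l with
  | nil => simp
  | cons a l ih =>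
    obtain ⟨ih1, ih2⟩ := ih fun x hx => h x (List.mem_cons_of_mem _ hx)
    have ha := h a List.mem_cons_self
    rw [List.map_cons, List.sum_cons, List.length_cons]
    refine ⟨by omega, fun e x hx => ?_⟩
    rcases List.mem_cons.1 hx with rfl | hx
    · omega
    · exact ih2 (by omega) x hx

theorem meetsOnce_of_countP_eq_one {T : Finset ℕ} {p : List ℕ} (h : p.countP (· ∈ T) = 1) :
    MeetsOnce T p := by
  rw [List.countP_eq_length_filter, List.length_eq_one_iff] at h
  obtain ⟨k, hk⟩ := h
  have hm : ∀ l, l ∈ p ∧ l ∈ T ↔ l = k := by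
    intro l
    rw [← List.mem_singleton, ← hk, List.mem_filter, decide_eq_true_eq]
  exact ⟨k, ((hm k).2 rfl).1, ((hm k).2 rfl).2, fun l h1 h2 => (hm l).1 ⟨h1, h2⟩⟩

theorem countP_le_one {T : Finset ℕ} {p : List ℕ}
    (h : p.Pairwise fun k l => ¬(k ∈ T ∧ l ∈ T)) : p.countP (· ∈ T) ≤ 1 := by
  induction h with
  | nil => simp
  | @cons a l hal _ ih =>
    rw [List.countP_cons]
    by_cases ha : a ∈ T
    · have : l.countP (· ∈ T) = 0 := by
        rw [List.countP_eq_zero]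
        intro x hx hxT
        exact hal x hx ⟨ha, of_decide_eq_true hxT⟩
      rw [this]
      simp [ha]
    · simpa [ha] using ih

/-- A plane is a clique, so two of its entries in `S` would be adjacent. -/
theorem countP_plane_le_one {S : Finset ThreeByThree} (hS : skewGraph.IsIndepSet S)
    {p : List ℕ} (hp : p ∈ planePositions codes) :
    p.countP (· ∈ S.image index) ≤ 1 := by
  rw [planePositions_eq] at hp
  obtain ⟨q, hq, rfl⟩ := List.mem_map.1 hp
  have h := List.all_eq_true.1 planes_all q hq
  rw [Bool.and_eq_true, List.all_eq_true] at h
  refine countP_le_one ?_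
  rw [List.pairwise_map]
  refine (pairwise_of_isPairwiseSkew h.2).imp_of_mem ?_
  rintro x y hx hy hxy ⟨h1, h2⟩
  obtain ⟨P, hP, hPx⟩ := Finset.mem_image.1 h1
  obtain ⟨Q, hQ, hQy⟩ := Finset.mem_image.1 h2
  have hskew : P.Skew Q :=
    (Represents.of_index_eq (h.1 x hx) hPx).skew (Represents.of_index_eq (h.1 y hy) hQy) hxy
  have hadj : skewGraph.Adj P Q := hskew
  exact hS hP hQ hadj.ne hadj

theorem sum_countP_planes (S : Finset ThreeByThree) :
    ((planePositions codes).map fun p => p.countP (· ∈ S.image index)).sum = S.card * 12 := by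
  rw [sum_countP_eq, Finset.sum_image index_injective.injOn,
    Finset.sum_congr rfl fun P _ => count_planePositions (index_lt P), Finset.sum_const,
    smul_eq_mul]

theorem length_planePositions : (planePositions codes).length = 840 := by
  rw [planePositions, List.length_map, length_planes]

theorem card_le {S : Finset ThreeByThree} (hS : skewGraph.IsIndepSet S) : S.card ≤ 70 := by
  have h := (sum_le_length fun p hp => countP_plane_le_one hS hp).1
  rw [sum_countP_planes, length_planePositions] at h
  omega

theorem meetsOnce_planes {S : Finset ThreeByThree} (hS : skewGraph.IsIndepSet S)
    (hc : S.card = 70) : ∀ p ∈ planePositions codes, MeetsOnce (S.image index) p := by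
  have h := (sum_le_length fun p hp => countP_plane_le_one hS hp).2
  rw [sum_countP_planes, length_planePositions, hc] at h
  exact fun p hp => meetsOnce_of_countP_eq_one (h rfl p hp)

/-! ### Sets attaining the bound -/

theorem exists_subset_sameCell {S : Finset ThreeByThree} (hS : skewGraph.IsIndepSet S)
    (hc : S.card = 70) : ∃ i j : Fin 9, i < j ∧ ∀ P ∈ S, P ∈ sameCell i j := by
  have hs := search_planes
  rw [forceList_eq, forceLists_eq, forceList_eq] at hs
  obtain ⟨g, hg, hgS⟩ := Consistent.search (T := S.image index)
    ⟨meetsOnce_planes hS hc, by simp, by simp⟩ hs fun k hk => by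
      obtain ⟨P, -, rfl⟩ := Finset.mem_image.1 hk
      rw [Nat.testBit_two_pow_sub_one]
      exact decide_eq_true (index_lt P)
  obtain ⟨j, hj, hg⟩ := List.mem_flatMap.1 hg
  obtain ⟨i, hi, rfl⟩ := List.mem_map.1 hg
  rw [List.mem_range] at hi hj
  refine ⟨⟨i, hi.trans hj⟩, ⟨j, hj⟩, hi, fun P hP => ?_⟩
  -- The goal mask has bit `index P` set, so the vertex `x` at that position joins `i` and `j`.
  -- Distinctness of the codes identifies it with the pair `y` representing `P`.
  obtain ⟨x, hx, hxt⟩ := (testBit_maskOf _ _ _).1 (hgS _ (Finset.mem_image_of_mem _ hP))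
  obtain ⟨y, hy, hyP⟩ := exists_vertex P
  have hsig : codes[index P]? = some (signature P) :=
    List.getElem?_idxOf (signature_mem_codes P)
  rw [codes, List.getElem?_map, hx, hyP.signature_eq, Option.map_some, Option.some_inj] at hsig
  have hxy : x = y :=
    List.inj_on_of_nodup_map nodup_codes (List.mem_of_getElem? hx) hy hsig
  rw [hyP.mem_sameCell, ← hxy]
  exact hxt

theorem finite_threeByThree : Finite ThreeByThree :=
  Finite.of_injective (fun P => (⟨index P, index_lt P⟩ : Fin 280)) fun _ _ h =>
    index_injective (Fin.mk.inj_iff.1 h)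

/-- The injective `signature` carries the set onto the codes of the vertices filtered in
`count_together`. -/
theorem ncard_sameCell {i j : Fin 9} (hij : i < j) : (sameCell i j).ncard = 70 := by
  have h : signature '' sameCell i j =
      (((vertices.filter (together i j)).map code).toFinset : Set ℕ) := by
    ext n
    rw [Set.mem_image, Finset.mem_coe, List.mem_toFinset, List.mem_map]
    constructor
    · rintro ⟨P, hP, rfl⟩
      obtain ⟨x, hx, h⟩ := exists_vertex P
      exact ⟨x, List.mem_filter.2 ⟨hx, h.mem_sameCell.1 hP⟩, h.signature_eq.symm⟩
    · rintro ⟨x, hx, rfl⟩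
      rw [List.mem_filter] at hx
      have hv : isVertex x = true := by
        obtain ⟨a, ha, hb⟩ := List.mem_flatMap.1 hx.1
        obtain ⟨b, hb', rfl⟩ := List.mem_map.1 hb
        obtain ⟨hb, hab⟩ := List.mem_filter.1 hb'
        simp only [Bool.and_eq_true] at hab
        exact isVertex_iff.2 ⟨ha, hb, Nat.eq_of_beq_eq_true hab.1.1⟩
      obtain ⟨P, hP⟩ := exists_represents hv
      exact ⟨P, hP.mem_sameCell.2 hx.2, hP.signature_eq⟩
  rw [← Set.ncard_image_of_injective _ signature_injective, h, Set.ncard_coe_finset,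
    List.toFinset_card_of_nodup (nodup_codes.sublist (List.filter_sublist.map _)),
    List.length_map]
  exact Nat.eq_of_beq_eq_true (List.all_eq_true.1 (List.all_eq_true.1 count_together j
    (List.mem_range.2 j.2)) i (List.mem_range.2 hij))

theorem isIndepSet_sameCell {i j : Fin 9} (hij : i < j) : skewGraph.IsIndepSet (sameCell i j) := by
  rintro P ⟨s, hs, his, hjs⟩ Q ⟨t, ht, hit, hjt⟩ - hadj
  have h : (s ∩ t).card = 1 := hadj s hs t ht
  have := Finset.card_le_one.1 h.le i (Finset.mem_inter.2 ⟨his, hit⟩) j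
    (Finset.mem_inter.2 ⟨hjs, hjt⟩)
  exact hij.ne this

theorem isNIndepSet_iff (S : Finset ThreeByThree) :
    skewGraph.IsNIndepSet 70 S ↔
      ∃ i j : Fin 9, i < j ∧ (S : Set ThreeByThree) = sameCell i j := by
  have := finite_threeByThree
  constructor
  · rintro ⟨hS, hc⟩
    obtain ⟨i, j, hij, h⟩ := exists_subset_sameCell hS hc
    -- The search gives only containment; equal cardinality 70 makes it equality.
    refine ⟨i, j, hij, Set.eq_of_subset_of_ncard_le h ?_ (Set.toFinite _)⟩
    rw [ncard_sameCell hij, Set.ncard_coe_finset, hc]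
  · rintro ⟨i, j, hij, h⟩
    refine ⟨h ▸ isIndepSet_sameCell hij, ?_⟩
    rw [← Set.ncard_coe_finset, h, ncard_sameCell hij]

end SkewSearch

open SkewSearch in
theorem mainTheorem2 :
    skewGraph.indepNum = 70 ∧
      ∀ S : Finset ThreeByThree,
        skewGraph.IsNIndepSet 70 S ↔
          ∃ i j : Fin 9, i < j ∧ (S : Set ThreeByThree) = sameCell i j := by
  refine ⟨le_antisymm ?_ ?_, isNIndepSet_iff⟩
  · have := finite_threeByThree
    obtain ⟨S, hS⟩ := skewGraph.exists_isNIndepSet_indepNum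
    exact hS.card_eq ▸ card_le hS.isIndepSet
  · have := finite_threeByThree
    have h01 : (0 : Fin 9) < 1 := by decide
    have hS := (isNIndepSet_iff (Set.toFinite (sameCell 0 1)).toFinset).2
      ⟨0, 1, h01, Set.Finite.coe_toFinset _⟩
    exact hS.card_eq ▸ hS.isIndepSet.card_le_indepNum
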